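/- **Setting.** Let $\Omega\subset\mathbb R^3$ be a bounded Lipschitz domain that is simply connected and has connected boundary. Let $w:\overline\Omega\times\mathbb R^3\to\mathbb R$ be piecewise continuous in $x$, with $w(x,\cdot)\in C^2(\mathbb R^3)$, $|w(x,0)|+|\partial_b w(x,0)|$ bounded uniformly in $x$, and $$\gamma|\xi|^2\le\langle\partial_{bb}w(x,\eta)\xi,\xi\rangle\le L|\xi|^2\qquad\forall x\in\overline\Omega,\ \xi,\eta\in\mathbb R^3,$$ with constants $\gamma,L>0$. Assume in addition that $|\partial_{bb}w(x,b_1)-\partial_{bb}w(x,b_2)|\le L''|b_1-b_2|$ for all $x\in\overline\Omega$ and $b_1,b_2\in\mathbb R^3$ (operator norm, $L''\ge0$). Let $\mathcal T_h$ be a geometrically conforming finite partition of $\Omega$ into closed tetrahedra $T$ which is shape-regular: $\operatorname{diam}T\le\kappa\,\rho$ for the diameter $\rho$ of some ball contained in $T$. Put $h_{\min}=\min_T\operatorname{diam}T$. Let $k\ge0$, let $\hat x_j$ be points of the closed reference tetrahedron and $\hat w_j>0$ weights, and let $x_{T,j}$ be the images of $\hat x_j$ under the affine maps onto the elements, such that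 $$\langle u,v\rangle_h:=\sum_{T}\sum_j u(x_{T,j})\cdot v(x_{T,j})\,\hat w_j|T|$$ equals $\int_\Omega u\cdot v\,dx$ for all piecewise polynomials $u,v\in P_k(\mathcal T_h)^3$. Let $W_h=\mathcal N_k(\mathcal T_h)\cap H_0(\operatorname{curl};\Omega)$ be the Nédélec space of the first kind (local space $P_k^3+x\times\widetilde P_k^3$, where $\widetilde P_k$ is the space of homogeneous polynomials of degree $k$), let $S_h=P_{k+1}(\mathcal T_h)\cap H^1_0(\Omega)$, and let $V_h$ be a subspace with $W_h=\nabla S_h\oplus V_h$ and $\|v_h\|_{H(\operatorname{curl})}\le C_*\|\operatorname{curl}v_h\|_{L^2(\Omega)}$ on $V_h$ for some $C_*>0$. Let $h_s\in H(\operatorname{curl};\Omega)\cap H^2(\mathcal T_h)^3$. Values at the points $x_{T,j}$ are taken from the element $T$. Let $a_h\in V_h$ be the minimizer over $V_h$ of the discrete energy $W(v_h)=\langle w(\operatorname{curl}v_h),1\rangle_h-\langle h_s,\operatorname{curl}v_h\rangle_h$. Let $0<\rho\le\frac12$, $0<\sigma<\frac12$. The damped Newton method starts from some $a_h^0\in V_h$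 and sets $a_h^{n+1}=a_h^n+\tau^n\delta a_h^n$, where $\delta a_h^n\in V_h$ satisfies $$\langle\partial_{bb}w(\operatorname{curl}a_h^n)\operatorname{curl}\delta a_h^n,\operatorname{curl}v_h\rangle_h=-\langle\partial_bw(\operatorname{curl}a_h^n)-h_s,\operatorname{curl}v_h\rangle_h\qquad\forall v_h\in V_h,$$ and $\tau^n$ is the largest number $\tau\in\{\rho^m:m\ge0\}$ with $W(a_h^n+\tau\,\delta a_h^n)\le W(a_h^n)+\sigma\tau\langle\partial_bw(\operatorname{curl}a_h^n)-h_s,\operatorname{curl}\delta a_h^n\rangle_h$. **Theorem 5 (local quadratic convergence).** There is a constant $C>0$, depending only on $k$ and the shape-regularity constant $\kappa$, and there is a radius $r>0$, depending only on $\Omega$, $k$, $\kappa$, $h_{\min}$, $\gamma$, $L$, $L''$, $\rho$ and $\sigma$, such that the following holds. Whenever $\|\operatorname{curl}(a_h^n-a_h)\|_{L^\infty(\Omega)}\le r$ for some $n\ge0$, the method takes the full step $\tau^n=1$, and $$\|\operatorname{curl}(a_h^{n+1}-a_h)\|_{L^2(\Omega)}\le C\,\frac{L''}{\gamma}\,h_{\min}^{-3/2}\,\|\operatorname{curl}(a_h^n-a_h)\|_{L^2(\Omega)}^2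 .$$ Moreover, in this case $\|\operatorname{curl}(a_h^m-a_h)\|_{L^\infty(\Omega)}\le r$ for all $m\ge n$ (so that full steps and the quadratic estimate persist), and $\|\operatorname{curl}(a_h^m-a_h)\|_{L^2(\Omega)}\to0$ as $m\to\infty$; i.e., the method converges locally quadratically. -/

import Mathlib

open MeasureTheory Filter Topology
open scoped ENNReal NNReal ContDiff

noncomputable section

namespace Magnetostatics

/-- Euclidean three-space. -/
abbrev E3 : Type := EuclideanSpace ℝ (Fin 3)

/-- The plane, used to parametrize Lipschitz boundaries. -/
abbrev E2 : Type := EuclideanSpace ℝ (Fin 2)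

/-! ### The domain -/

/-- Every boundary point has a neighbourhood in which, after an orthogonal change of coordinates,
the set is the region strictly above the graph of a Lipschitz function of two variables. -/
def HasLipschitzBoundary (Ω : Set E3) : Prop :=
  ∀ x ∈ frontier Ω, ∃ (e : E3 ≃ₗᵢ[ℝ] E3) (φ : E2 → ℝ) (K : ℝ≥0), LipschitzWith K φ ∧
    ∀ᶠ y in 𝓝 x, (y ∈ Ω ↔ φ !₂[e y 0, e y 1] < e y 2)

/-- Bounded Lipschitz domain of trivial topology: simply connected with connected boundary. -/
structure IsAdmissibleDomain (Ω : Set E3) : Prop where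
  isOpen : IsOpen Ω
  isBounded : Bornology.IsBounded Ω
  lipschitz : HasLipschitzBoundary Ω
  simplyConnected : SimplyConnectedSpace Ω
  connected_frontier : IsConnected (frontier Ω)

/-! ### Scalar products, norms and function spaces on open sets -/

/-- The norm `‖f‖` in `L²(Ω)`. -/
def l2Norm {F : Type*} [NormedAddCommGroup F] (Ω : Set E3) (f : E3 → F) : ℝ :=
  Real.sqrt (∫ x in Ω, ‖f x‖ ^ 2)

/-- The norm `‖f‖` in `L^∞(Ω)`, with values in `[0, ∞]`. -/
def linftyNorm {F : Type*} [NormedAddCommGroup F] (Ω : Set E3) (f : E3 → F) : ℝ≥0∞ :=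
  eLpNorm f ∞ (volume.restrict Ω)

/-- Square integrability over `Ω`. -/
def MemL2 {F : Type*} [NormedAddCommGroup F] (Ω : Set E3) (f : E3 → F) : Prop :=
  MemLp f 2 (volume.restrict Ω)

/-- Smooth functions with compact support in `Ω`. -/
structure IsTest {F : Type*} [NormedAddCommGroup F] [NormedSpace ℝ F]
    (Ω : Set E3) (φ : E3 → F) : Prop where
  smooth : ContDiff ℝ ∞ φ
  compact : HasCompactSupport φ
  support : tsupport φ ⊆ Ω

/-- The classical partial derivative in the coordinate direction `i`. -/
def partialDeriv {F : Type*} [NormedAddCommGroup F] [NormedSpace ℝ F]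
    (i : Fin 3) (φ : E3 → F) (x : E3) : F :=
  fderiv ℝ φ x (EuclideanSpace.single i 1)

/-- The classical curl; the index arithmetic is modulo three, so that the component `c` is
`∂_{c+1} φ_{c+2} - ∂_{c+2} φ_{c+1}`. -/
def curl (φ : E3 → E3) (x : E3) : E3 :=
  WithLp.toLp 2 fun c : Fin 3 =>
    partialDeriv (c + 1) φ x (c + 2) - partialDeriv (c + 2) φ x (c + 1)

/-- `g` is the weak curl of `u` on `Ω`. -/
def HasWeakCurl (Ω : Set E3) (u g : E3 → E3) : Prop :=
  ∀ φ : E3 → E3, IsTest Ω φ →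
    ∫ x in Ω, inner ℝ (u x) (curl φ x) = ∫ x in Ω, inner ℝ (g x) (φ x)

/-- `g` is the weak partial derivative of `u` on `Ω` in the coordinate direction `i`. -/
def HasWeakPartial (Ω : Set E3) (i : Fin 3) (u g : E3 → ℝ) : Prop :=
  ∀ φ : E3 → ℝ, IsTest Ω φ →
    ∫ x in Ω, u x * partialDeriv i φ x = - ∫ x in Ω, g x * φ x

/-- The space `H(curl; Ω)`. -/
def MemHCurl (Ω : Set E3) (u : E3 → E3) : Prop :=
  MemL2 Ω u ∧ ∃ g : E3 → E3, MemL2 Ω g ∧ HasWeakCurl Ω u g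

/-- The space `H₀(curl; Ω)`: the closure of the smooth compactly supported fields in
`H(curl; Ω)`. -/
def MemH0Curl (Ω : Set E3) (u : E3 → E3) : Prop :=
  MemL2 Ω u ∧ ∃ g : E3 → E3, MemL2 Ω g ∧ HasWeakCurl Ω u g ∧
    ∀ ε > 0, ∃ φ : E3 → E3, IsTest Ω φ ∧
      l2Norm Ω (fun x => u x - φ x) < ε ∧ l2Norm Ω (fun x => g x - curl φ x) < ε

/-- The space `H₀¹(Ω)`: the closure of the smooth compactly supported functions in `H¹(Ω)`. -/
def MemH01 (Ω : Set E3) (u : E3 → ℝ) : Prop :=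
  MemL2 Ω u ∧ ∃ g : Fin 3 → E3 → ℝ, (∀ i, MemL2 Ω (g i) ∧ HasWeakPartial Ω i u (g i)) ∧
    ∀ ε > 0, ∃ φ : E3 → ℝ, IsTest Ω φ ∧
      l2Norm Ω (fun x => u x - φ x) < ε ∧
      ∀ i, l2Norm Ω (fun x => g i x - partialDeriv i φ x) < ε

/-- The scalar Sobolev space `H^m(Ω)`. -/
def MemSobolev (Ω : Set E3) : ℕ → (E3 → ℝ) → Prop
  | 0, u => MemL2 Ω u
  | m + 1, u => MemL2 Ω u ∧ ∀ i : Fin 3, ∃ g : E3 → ℝ, HasWeakPartial Ω i u g ∧ MemSobolev Ω m g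

/-! ### The energy density -/

/-- The first derivative `∂_b w(x, b)`, as a vector. -/
def dw (w : E3 → E3 → ℝ) (x b : E3) : E3 := gradient (w x) b

/-- The second derivative `∂_bb w(x, b)`, as a linear operator. -/
def ddw (w : E3 → E3 → ℝ) (x b : E3) : E3 →L[ℝ] E3 := fderiv ℝ (gradient (w x)) b

/-- Piecewise continuity of `w(·, b)`: there are finitely many disjoint open pieces with null
boundaries whose closures cover the closure of `Ω`, and on each piece `w(·, b)` coincides with
a function that is continuous up to the boundary of the piece. -/
def IsPiecewiseContinuous (Ω : Set E3) (w : E3 → E3 → ℝ) : Prop :=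
  ∃ (m : ℕ) (D : Fin m → Set E3),
    (∀ i, IsOpen (D i) ∧ D i ⊆ Ω ∧ volume (frontier (D i)) = 0) ∧
    Pairwise (fun i j => Disjoint (D i) (D j)) ∧
    closure Ω ⊆ ⋃ i, closure (D i) ∧
    ∀ (b : E3) (i : Fin m), ∃ g : E3 → ℝ,
      ContinuousOn g (closure (D i)) ∧ Set.EqOn (fun x => w x b) g (D i)

/-- The conditions on the energy density `w` with ellipticity constants `γ` and `L`. -/
structure IsAdmissibleEnergy (Ω : Set E3) (γ L : ℝ) (w : E3 → E3 → ℝ) : Prop where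
  piecewise_continuous : IsPiecewiseContinuous Ω w
  contDiff : ∀ x ∈ closure Ω, ContDiff ℝ 2 (w x)
  bounded_at_zero : ∃ C : ℝ, ∀ x ∈ closure Ω, |w x 0| + ‖dw w x 0‖ ≤ C
  lower : ∀ x ∈ closure Ω, ∀ η ξ : E3, γ * ‖ξ‖ ^ 2 ≤ inner ℝ (ddw w x η ξ) ξ
  upper : ∀ x ∈ closure Ω, ∀ η ξ : E3, inner ℝ (ddw w x η ξ) ξ ≤ L * ‖ξ‖ ^ 2

/-- `∂_bb w` is Lipschitz continuous in the second argument with constant `M`, uniformly in the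
first one; matrices are measured in the operator norm. -/
def HasLipschitzHessian (Ω : Set E3) (M : ℝ) (w : E3 → E3 → ℝ) : Prop :=
  ∀ x ∈ closure Ω, ∀ b₁ b₂ : E3, ‖ddw w x b₁ - ddw w x b₂‖ ≤ M * ‖b₁ - b₂‖

/-! ### Tetrahedral meshes -/

/-- A geometrically conforming finite partition of `Ω` into nondegenerate closed tetrahedra: two
elements meet exactly in the (possibly empty) face spanned by their common vertices. The vertices
are numbered, which fixes the affine map from the reference element. -/
structure Mesh (Ω : Set E3) where
  N : ℕ
  tet : Fin N → Affine.Simplex ℝ E3 3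
  cover : ⋃ i, convexHull ℝ (Set.range (tet i).points) = closure Ω
  interior_subset : ∀ i, interior (convexHull ℝ (Set.range (tet i).points)) ⊆ Ω
  distinct : ∀ i j, i ≠ j → Set.range (tet i).points ≠ Set.range (tet j).points
  conforming : ∀ i j,
    convexHull ℝ (Set.range (tet i).points) ∩ convexHull ℝ (Set.range (tet j).points)
      = convexHull ℝ (Set.range (tet i).points ∩ Set.range (tet j).points)

namespace Mesh

variable {Ω : Set E3} (𝒯 : Mesh Ω)

/-- The closed tetrahedron with index `i`. -/
def cell (i : Fin 𝒯.N) : Set E3 := convexHull ℝ (Set.range (𝒯.tet i).points)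

/-- The volume of an element. -/
def cellVol (i : Fin 𝒯.N) : ℝ := (volume (𝒯.cell i)).toReal

/-- The affine map from the reference element onto the element with index `i`. -/
def refMap (i : Fin 𝒯.N) (y : E3) : E3 :=
  (𝒯.tet i).points 0 + ∑ c : Fin 3, y c • ((𝒯.tet i).points c.succ - (𝒯.tet i).points 0)

/-- The minimal element diameter. -/
def hMin : ℝ := ⨅ i, Metric.diam (𝒯.cell i)

/-- Shape regularity: the diameter of each element is at most `κ` times the diameter of some ball
contained in it. -/
def IsShapeRegular (κ : ℝ) : Prop :=
  ∀ i, ∃ (z : E3) (ρ : ℝ), 0 < ρ ∧ Metric.closedBall z ρ ⊆ 𝒯.cell i ∧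
    Metric.diam (𝒯.cell i) ≤ κ * (2 * ρ)

/-- The function on `Ω` which is given by `F i` in the interior of the element `i` (its values on
the element boundaries, a null set, are irrelevant and set to zero). -/
def glue {F : Type*} [AddCommMonoid F] (f : Fin 𝒯.N → E3 → F) (x : E3) : F :=
  ∑ i, (interior (𝒯.cell i)).indicator (f i) x

end Mesh

/-! ### Piecewise polynomial spaces -/

/-- Scalar polynomials in three variables. -/
abbrev Poly : Type := MvPolynomial (Fin 3) ℝ

/-- Polynomial vector fields in three variables. -/
abbrev PolyField : Type := Fin 3 → Poly

/-- The function defined by a polynomial. -/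
def polyFun (p : Poly) (x : E3) : ℝ := MvPolynomial.eval (fun j => x j) p

/-- The vector field defined by three polynomials. -/
def polyFieldFun (p : PolyField) (x : E3) : E3 := WithLp.toLp 2 fun c => polyFun (p c) x

/-- The curl of a polynomial vector field. -/
def polyCurl (p : PolyField) : PolyField := fun c =>
  MvPolynomial.pderiv (c + 1) (p (c + 2)) - MvPolynomial.pderiv (c + 2) (p (c + 1))

/-- The gradient of a polynomial. -/
def polyGrad (s : Poly) : PolyField := fun c => MvPolynomial.pderiv c s

/-- The local Nédélec space of the first kind: `P_k³ + x × (homogeneous P_k)³`. -/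
def IsNedelec (k : ℕ) (v : PolyField) : Prop :=
  ∃ p q : PolyField, (∀ c, (p c).totalDegree ≤ k) ∧ (∀ c, (q c).IsHomogeneous k) ∧
    v = p + crossProduct (fun j => (MvPolynomial.X j : Poly)) q

namespace Mesh

variable {Ω : Set E3} (𝒯 : Mesh Ω)

/-- Piecewise polynomial vector fields, without a bound on the degree. -/
abbrev PwField : Type := Fin 𝒯.N → PolyField

/-- The function on `Ω` defined by a piecewise polynomial vector field. -/
def fieldFun (v : 𝒯.PwField) : E3 → E3 := 𝒯.glue fun i => polyFieldFun (v i)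

/-- The elementwise curl. For fields in `H(curl; Ω)` this is the weak curl. -/
def pwCurl (v : 𝒯.PwField) : 𝒯.PwField := fun i => polyCurl (v i)

/-- The function `curl v` on `Ω`. -/
def curlFun (v : 𝒯.PwField) : E3 → E3 := 𝒯.fieldFun (𝒯.pwCurl v)

/-- The space `P_k(𝒯)³`. -/
def IsPwDegreeLE (k : ℕ) (v : 𝒯.PwField) : Prop := ∀ i c, (v i c).totalDegree ≤ k

/-- The space `W_h`: Nédélec elements of order `k` in `H₀(curl; Ω)`. -/
def nedelecSpace (k : ℕ) : Set 𝒯.PwField :=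
  {v | (∀ i, IsNedelec k (v i)) ∧ MemH0Curl Ω (𝒯.fieldFun v)}

/-- The space `S_h`: piecewise polynomials of degree at most `k + 1` in `H₀¹(Ω)`. -/
def lagrangeSpace (k : ℕ) : Set (Fin 𝒯.N → Poly) :=
  {s | (∀ i, (s i).totalDegree ≤ k + 1) ∧ MemH01 Ω (𝒯.glue fun i => polyFun (s i))}

/-- The elementwise gradient. -/
def pwGrad (s : Fin 𝒯.N → Poly) : 𝒯.PwField := fun i => polyGrad (s i)

/-- The space `V` is an admissible choice of `V_h`: the sum `W_h = ∇ S_h ⊕ V` is direct and the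
splitting is stable. -/
structure IsStableComplement (k : ℕ) (V : Submodule ℝ 𝒯.PwField) : Prop where
  sum : 𝒯.nedelecSpace k = {u | ∃ s ∈ 𝒯.lagrangeSpace k, ∃ v ∈ V, u = 𝒯.pwGrad s + v}
  direct : ∀ s ∈ 𝒯.lagrangeSpace k, 𝒯.pwGrad s ∈ V → 𝒯.pwGrad s = 0
  stable : ∃ Cs > 0, ∀ v ∈ V,
    Real.sqrt (l2Norm Ω (𝒯.fieldFun v) ^ 2 + l2Norm Ω (𝒯.curlFun v) ^ 2)
      ≤ Cs * l2Norm Ω (𝒯.curlFun v)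

/-- The source field belongs to `H(curl; Ω)` and is piecewise `H²`. On each element it is given by
its representative that is continuous up to the boundary of the element, so that it can be
evaluated at the integration points. -/
structure IsSource (hs : Fin 𝒯.N → E3 → E3) : Prop where
  continuousOn : ∀ i, ContinuousOn (hs i) (𝒯.cell i)
  piecewise_H2 : ∀ i, ∀ c : Fin 3, MemSobolev (interior (𝒯.cell i)) 2 fun x => hs i x c
  hCurl : MemHCurl Ω (𝒯.glue hs)

end Mesh

/-! ### Numerical quadrature -/

/-- A quadrature rule: points and weights. -/
structure QuadRule where
  card : ℕ
  pt : Fin card → E3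
  wt : Fin card → ℝ

/-- The closed reference tetrahedron. -/
def refTet : Set E3 := {y | (∀ c, 0 ≤ y c) ∧ ∑ c, y c ≤ 1}

namespace Mesh

variable {Ω : Set E3} (𝒯 : Mesh Ω) (Q : QuadRule)

/-- Elementwise numerical integration `∑_T ∑_j f_T(x_{T,j}) ŵ_j |T|` of a piecewise function. -/
def quad (f : Fin 𝒯.N → E3 → ℝ) : ℝ :=
  ∑ i, ∑ j, f i (𝒯.refMap i (Q.pt j)) * Q.wt j * 𝒯.cellVol i

/-- The discrete scalar product of piecewise vector fields. -/
def innerH (u v : Fin 𝒯.N → E3 → E3) : ℝ := 𝒯.quad Q fun i x => inner ℝ (u i x) (v i x)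

/-- The quadrature rule has points in the reference element and positive weights, and the discrete
scalar product is exact on `P_k(𝒯)³`. -/
structure IsAdmissibleRule (k : ℕ) : Prop where
  mem_refTet : ∀ j, Q.pt j ∈ refTet
  wt_pos : ∀ j, 0 < Q.wt j
  exact : ∀ u v : 𝒯.PwField, 𝒯.IsPwDegreeLE k u → 𝒯.IsPwDegreeLE k v →
    𝒯.innerH Q (fun i => polyFieldFun (u i)) (fun i => polyFieldFun (v i))
      = ∫ x in Ω, inner ℝ (𝒯.fieldFun u x) (𝒯.fieldFun v x)

/-! ### The discrete problem and the damped Newton method -/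

variable (w : E3 → E3 → ℝ) (hs : Fin 𝒯.N → E3 → E3)

/-- The elementwise function `curl v`, evaluated on the closed elements. -/
def curlOn (v : 𝒯.PwField) : Fin 𝒯.N → E3 → E3 := fun i => polyFieldFun (polyCurl (v i))

/-- The discrete energy `⟨w(curl v), 1⟩_h - ⟨h_s, curl v⟩_h`. -/
def energy (v : 𝒯.PwField) : ℝ :=
  𝒯.quad Q (fun i x => w x (𝒯.curlOn v i x)) - 𝒯.innerH Q hs (𝒯.curlOn v)

/-- `a` solves the discrete minimization problem over `V`. -/
def IsDiscreteSolution (V : Submodule ℝ 𝒯.PwField) (a : 𝒯.PwField) : Prop :=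
  a ∈ V ∧ ∀ v ∈ V, 𝒯.energy Q w hs a ≤ 𝒯.energy Q w hs v

/-- The derivative `⟨∂_b w(curl a) - h_s, curl v⟩_h` of the energy at `a` in direction `v`. -/
def residual (a v : 𝒯.PwField) : ℝ :=
  𝒯.innerH Q (fun i x => dw w x (𝒯.curlOn a i x) - hs i x) (𝒯.curlOn v)

/-- `δ` is the Newton increment at `a`. -/
def IsNewtonIncrement (V : Submodule ℝ 𝒯.PwField) (a δ : 𝒯.PwField) : Prop :=
  δ ∈ V ∧ ∀ v ∈ V,
    𝒯.innerH Q (fun i x => ddw w x (𝒯.curlOn a i x) (𝒯.curlOn δ i x)) (𝒯.curlOn v)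
      = - 𝒯.residual Q w hs a v

/-- `τ` is the step size selected by Armijo back-tracking with parameters `ρ` and `σ`. -/
def IsArmijoStep (ρ σ : ℝ) (a δ : 𝒯.PwField) (τ : ℝ) : Prop :=
  IsGreatest {t : ℝ | (∃ m : ℕ, t = ρ ^ m) ∧
    𝒯.energy Q w hs (a + t • δ) ≤ 𝒯.energy Q w hs a + σ * t * 𝒯.residual Q w hs a δ} τ

/-- The iterates `a n`, increments `δ n` and step sizes `τ n` are generated by the damped Newton
method with some initial value `a 0` in `V`. -/
structure IsDampedNewton (V : Submodule ℝ 𝒯.PwField) (ρ σ : ℝ)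
    (a δ : ℕ → 𝒯.PwField) (τ : ℕ → ℝ) : Prop where
  init : a 0 ∈ V
  increment : ∀ n, 𝒯.IsNewtonIncrement Q w hs V (a n) (δ n)
  step : ∀ n, 𝒯.IsArmijoStep Q w hs ρ σ (a n) (δ n) (τ n)
  update : ∀ n, a (n + 1) = a n + τ n • δ n

end Mesh

end Magnetostatics

end

namespace Magnetostatics

/-! ### Polynomials -/

/-! Write `e = a n - ah` and let `v = a n + δ n - ah` be the error after a full step. Subtracting
the first-order condition at the minimizer from the Newton equation gives `⟨H curl v, curl v⟩_h =
⟨R, curl v⟩_h`, where `H` is the Hessian of the density at `curl (a n)` and `R` is the Taylor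
remainder of `∂_b w`, pointwise at most `M |curl e|²`. Coercivity of `H` yields `‖curl v‖ ≤ (M/γ)
sup |curl e| ‖curl e‖` (`l2Norm_newton_error_le`). Passing between the quadrature and `L²` costs
nothing: the curl of a Nédélec field of order `k` has degree at most `k`, where the rule is exact,
and positive weights preserve pointwise inequalities.

The inverse estimate `exists_norm_curlOn_le` replaces the supremum by `C h^(-3/2) ‖curl e‖`, which
makes the bound quadratic. It comes from equivalence of norms on polynomials of bounded degree,
transported to each element by scaling an inscribed ball.

Testing the Newton equation with `δ n` shows that a full step lowers the energy by half of
`-residual`, up to a cubic Taylor error. Since `σ < 1/2`, that error is absorbed once `curl (δ n)`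
is small (`armijo_full_step`). Going from `L^∞` to `L²` costs `√|Ω|` and the way back costs the
inverse constant; for small `r` the quadratic gain pays for both, so the ball of radius `r` is
invariant and the `L²` errors at least halve. -/

theorem totalDegree_pderiv_le {p : Poly} {k : ℕ} (hp : p.totalDegree ≤ k + 1) (i : Fin 3) :
    (MvPolynomial.pderiv i p).totalDegree ≤ k := by
  refine Finset.sup_le fun m hm => ?_
  rw [MvPolynomial.mem_support_iff, MvPolynomial.coeff_pderiv] at hm
  have h1 := MvPolynomial.le_totalDegree
    (MvPolynomial.mem_support_iff.2 (left_ne_zero_of_mul hm))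
  rw [Finsupp.sum_add_index' (by simp) (by simp), Finsupp.sum_single_index rfl] at h1
  omega

/-- Rescaling a ball to the unit ball is an affine substitution; this bound keeps the rescaled
polynomial in the same finite-dimensional space. -/
theorem totalDegree_bind₁_le {p : Poly} {k : ℕ} (hp : p.totalDegree ≤ k) (f : Fin 3 → Poly)
    (hf : ∀ j, (f j).totalDegree ≤ 1) : (MvPolynomial.bind₁ f p).totalDegree ≤ k := by
  rw [MvPolynomial.bind₁, MvPolynomial.aeval_def, MvPolynomial.eval₂_eq']
  refine MvPolynomial.totalDegree_finsetSum_le fun m hm => ?_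
  refine (MvPolynomial.totalDegree_mul _ _).trans ?_
  have h2 : (∏ i, f i ^ m i).totalDegree ≤ ∑ i, m i := by
    refine (MvPolynomial.totalDegree_finsetProd _ _).trans (Finset.sum_le_sum fun i _ => ?_)
    refine (MvPolynomial.totalDegree_pow _ _).trans ?_
    nlinarith [hf i]
  have h1 := MvPolynomial.le_totalDegree hm
  rw [Finsupp.sum_fintype _ _ (by simp)] at h1
  rw [show (algebraMap ℝ Poly) (p.coeff m) = MvPolynomial.C (p.coeff m) from rfl,
    MvPolynomial.totalDegree_C]
  omega

theorem continuous_polyFun (p : Poly) : Continuous (polyFun p) := by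
  unfold polyFun
  exact (MvPolynomial.continuous_eval p).comp (by fun_prop)

theorem continuous_polyFieldFun (p : PolyField) : Continuous (polyFieldFun p) := by
  unfold polyFieldFun
  exact (PiLp.continuous_toLp 2 _).comp (continuous_pi fun c => continuous_polyFun (p c))

theorem norm_polyFieldFun_sq (p : PolyField) (x : E3) :
    ‖polyFieldFun p x‖ ^ 2 = ∑ c, polyFun (p c) x ^ 2 := by
  rw [EuclideanSpace.norm_sq_eq]
  simp [polyFieldFun]

theorem IsNedelec.totalDegree_le {k : ℕ} {v : PolyField} (hv : IsNedelec k v) (c : Fin 3) :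
    (v c).totalDegree ≤ k + 1 := by
  obtain ⟨p, q, hp, hq, rfl⟩ := hv
  have hmul : ∀ i j, ((MvPolynomial.X i : Poly) * q j).totalDegree ≤ k + 1 := fun i j => by
    refine (MvPolynomial.totalDegree_mul _ _).trans ?_
    rw [MvPolynomial.totalDegree_X]
    have := (hq j).totalDegree_le
    omega
  rw [Pi.add_apply]
  refine (MvPolynomial.totalDegree_add _ _).trans (max_le ((hp c).trans (by omega)) ?_)
  rw [cross_apply]
  fin_cases c <;>
  exact (MvPolynomial.totalDegree_sub _ _).trans (max_le (hmul _ _) (hmul _ _))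

theorem IsNedelec.totalDegree_polyCurl_le {k : ℕ} {v : PolyField} (hv : IsNedelec k v)
    (c : Fin 3) : (polyCurl v c).totalDegree ≤ k :=
  (MvPolynomial.totalDegree_sub _ _).trans
    (max_le (totalDegree_pderiv_le (hv.totalDegree_le _) _)
      (totalDegree_pderiv_le (hv.totalDegree_le _) _))

theorem polyFieldFun_add (p q : PolyField) (x : E3) :
    polyFieldFun (p + q) x = polyFieldFun p x + polyFieldFun q x := by
  ext c; simp [polyFieldFun, polyFun]

theorem polyFieldFun_smul (t : ℝ) (p : PolyField) (x : E3) :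
    polyFieldFun (t • p) x = t • polyFieldFun p x := by
  ext c; simp [polyFieldFun, polyFun, MvPolynomial.smul_eval]

theorem polyFieldFun_zero (x : E3) : polyFieldFun 0 x = 0 := by
  ext c; simp [polyFieldFun, polyFun]

theorem polyCurl_add (p q : PolyField) : polyCurl (p + q) = polyCurl p + polyCurl q := by
  ext1 c; simp [polyCurl]; ring

theorem polyCurl_smul (t : ℝ) (p : PolyField) : polyCurl (t • p) = t • polyCurl p := by
  ext1 c; simp [polyCurl, smul_sub]

/-! ### The inverse estimate -/

theorem memLp_polyFun_ball (p : Poly) :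
    MemLp (polyFun p) 2 (volume.restrict (Metric.ball (0 : E3) 1)) := by
  have hc := continuous_polyFun p
  obtain ⟨B, hB⟩ := (isCompact_closedBall (0 : E3) 1).exists_bound_of_continuousOn hc.continuousOn
  have : IsFiniteMeasure (volume.restrict (Metric.ball (0 : E3) 1)) :=
    ⟨by simp⟩
  refine MemLp.of_bound hc.aestronglyMeasurable B ?_
  filter_upwards [ae_restrict_mem measurableSet_ball] with x hx
  exact hB x (Metric.ball_subset_closedBall hx)

theorem eq_zero_of_ae_zero_ball {p : Poly}
    (hp : polyFun p =ᵐ[volume.restrict (Metric.ball (0 : E3) 1)] 0) : p = 0 := by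
  have h0 := Measure.eqOn_open_of_ae_eq hp Metric.isOpen_ball
    (continuous_polyFun p).continuousOn continuousOn_const
  -- The cube with half-side 1/2 lies in the unit ball because 3 · 1/4 < 1, and a product of
  -- infinite sets determines a polynomial.
  refine MvPolynomial.funext_set (fun _ => Set.Ioo (-(1 / 2) : ℝ) (1 / 2))
    (fun _ => Set.Ioo_infinite (by norm_num)) fun x hx => ?_
  rw [map_zero]
  refine h0 (x := WithLp.toLp 2 x) ?_
  have hx' : ∀ i, x i ^ 2 ≤ 1 / 4 := fun i => by
    have := hx i trivial
    nlinarith [this.1, this.2]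
  rw [mem_ball_zero_iff, ← sq_lt_one_iff₀ (norm_nonneg _), EuclideanSpace.norm_sq_eq,
    Fin.sum_univ_three]
  simp only [Real.norm_eq_abs, sq_abs]
  linarith [hx' 0, hx' 1, hx' 2]

/-- Polynomials of degree at most `k` form a finite-dimensional space that embeds into `L²` of the
unit ball. The inverse of the embedding, followed by restriction to the ball of radius `R`, is
therefore a bounded map into continuous functions. -/
theorem exists_sq_polyFun_le_setIntegral_ball (k : ℕ) (R : ℝ) :
    ∃ K : ℝ, 0 < K ∧ ∀ p : Poly, p.totalDegree ≤ k → ∀ x ∈ Metric.closedBall (0 : E3) R,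
      polyFun p x ^ 2 ≤ K * ∫ y in Metric.ball (0 : E3) 1, polyFun p y ^ 2 := by
  let μ := volume.restrict (Metric.ball (0 : E3) 1)
  let Φ : MvPolynomial.restrictTotalDegree (Fin 3) ℝ k →ₗ[ℝ] Lp ℝ 2 μ :=
    { toFun := fun p => (memLp_polyFun_ball p.1).toLp _
      map_add' := fun p q => by
        rw [← MemLp.toLp_add]; congr 1; ext x; simp [polyFun]
      map_smul' := fun t p => by
        rw [RingHom.id_apply, ← MemLp.toLp_const_smul]; congr 1; ext x
        simp [polyFun, MvPolynomial.smul_eval] }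
  have hΦ : Function.Injective Φ := by
    rw [injective_iff_map_eq_zero]
    intro p hp
    have h1 : (memLp_polyFun_ball p.1).toLp _ = 0 := hp
    have h2 := (memLp_polyFun_ball p.1).coeFn_toLp.symm
    rw [h1] at h2
    exact Subtype.ext (eq_zero_of_ae_zero_ball (h2.trans (Lp.coeFn_zero _ _ _)))
  let G : MvPolynomial.restrictTotalDegree (Fin 3) ℝ k →ₗ[ℝ] C(Metric.closedBall (0 : E3) R, ℝ) :=
    { toFun := fun p => ⟨fun x => polyFun p.1 x, (continuous_polyFun p.1).comp (by fun_prop)⟩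
      map_add' := fun p q => by ext x; simp [polyFun]
      map_smul' := fun t p => by ext x; simp [polyFun, MvPolynomial.smul_eval] }
  have : CompactSpace (Metric.closedBall (0 : E3) R) :=
    isCompact_iff_compactSpace.1 (isCompact_closedBall _ _)
  let e := LinearEquiv.ofInjective Φ hΦ
  have : FiniteDimensional ℝ Φ.range := Module.Finite.equiv e
  let A := LinearMap.toContinuousLinearMap (G ∘ₗ e.symm.toLinearMap)
  refine ⟨(‖A‖ + 1) ^ 2, by positivity, fun p hp x hx => ?_⟩
  let p' : MvPolynomial.restrictTotalDegree (Fin 3) ℝ k :=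
    ⟨p, (MvPolynomial.mem_restrictTotalDegree _ _ _).2 hp⟩
  have h1 : A (e p') = G p' := by simp [A]
  have h2 : |polyFun p x| ≤ ‖A‖ * ‖Φ p'‖ := by
    calc |polyFun p x| = ‖(G p') ⟨x, hx⟩‖ := rfl
      _ ≤ ‖G p'‖ := ContinuousMap.norm_coe_le_norm _ _
      _ ≤ ‖A‖ * ‖e p'‖ := h1 ▸ A.le_opNorm _
      _ = _ := rfl
  have h3 : ‖Φ p'‖ ^ 2 = ∫ y in Metric.ball (0 : E3) 1, polyFun p y ^ 2 := by
    rw [← real_inner_self_eq_norm_sq, L2.inner_def]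
    refine integral_congr_ae ?_
    filter_upwards [(memLp_polyFun_ball p).coeFn_toLp] with y hy
    change inner ℝ ((memLp_polyFun_ball p).toLp _ y) ((memLp_polyFun_ball p).toLp _ y) = _
    rw [hy]
    simp [sq]
  rw [← h3, ← sq_abs, ← mul_pow]
  exact pow_le_pow_left₀ (abs_nonneg _)
    (h2.trans (mul_le_mul_of_nonneg_right (by linarith) (norm_nonneg _))) 2

theorem polyFun_bind₁_affine (p : Poly) (z y : E3) (ρ : ℝ) :
    polyFun (MvPolynomial.bind₁
      (fun j => MvPolynomial.C (z j) + MvPolynomial.C ρ * MvPolynomial.X j) p) y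
      = polyFun p (z + ρ • y) := by
  unfold polyFun
  rw [← MvPolynomial.coe_aeval_eq_eval, ← MvPolynomial.coe_aeval_eq_eval]
  change MvPolynomial.aeval _ _ = MvPolynomial.aeval _ _
  rw [MvPolynomial.aeval_bind₁]
  congr 2
  ext j
  simp

theorem setIntegral_ball_comp_affine (f : E3 → ℝ) (z : E3) {ρ : ℝ} (hρ : 0 < ρ) :
    ∫ y in Metric.ball (0 : E3) 1, f (z + ρ • y) = (ρ ^ 3)⁻¹ * ∫ y in Metric.ball z ρ, f y := by
  rw [← integral_indicator measurableSet_ball, ← integral_indicator measurableSet_ball]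
  have h : ∀ y : E3, (Metric.ball (0 : E3) 1).indicator (fun y => f (z + ρ • y)) y
      = (fun u => (Metric.ball z ρ).indicator f (z + u)) (ρ • y) := fun y => by
    have : y ∈ Metric.ball (0 : E3) 1 ↔ z + ρ • y ∈ Metric.ball z ρ := by
      rw [mem_ball_zero_iff, mem_ball_iff_norm, add_sub_cancel_left, norm_smul, Real.norm_eq_abs,
        abs_of_pos hρ, mul_lt_iff_lt_one_right hρ]
    by_cases hy : y ∈ Metric.ball (0 : E3) 1
    · simp only [Set.indicator_of_mem hy, Set.indicator_of_mem (this.1 hy)]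
    · simp only [Set.indicator_of_notMem hy, Set.indicator_of_notMem (this.not.1 hy)]
  simp_rw [h]
  rw [Measure.integral_comp_smul volume
    (fun u => (Metric.ball z ρ).indicator f (z + u)) ρ, integral_add_left_eq_self]
  simp [abs_of_pos hρ]

/-- Inverse estimate: on a set between two concentric balls with comparable radii, the values of
a polynomial field are bounded by its scaled `L²`-norm. -/
theorem exists_inverse_estimate (k : ℕ) (κ : ℝ) :
    ∃ K : ℝ, 0 < K ∧ ∀ (S : Set E3) (z : E3) (ρ h : ℝ), Bornology.IsBounded S → 0 < ρ → 0 < h →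
      Metric.closedBall z ρ ⊆ S → Metric.diam S ≤ κ * (2 * ρ) → h ≤ Metric.diam S →
      ∀ p : PolyField, (∀ c, (p c).totalDegree ≤ k) → ∀ x ∈ S,
        ‖polyFieldFun p x‖ ^ 2
          ≤ K * h⁻¹ ^ 3 * ∫ y in interior S, ‖polyFieldFun p y‖ ^ 2 := by
  obtain ⟨K, hK, hKb⟩ := exists_sq_polyFun_le_setIntegral_ball k (2 * κ)
  refine ⟨K * (2 * |κ| + 1) ^ 3, by positivity, ?_⟩
  intro S z ρ h hS hρ hh hball hdiam hhd p hp x hx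
  -- From `h ≤ diam S ≤ 2κρ`; the factor `2|κ| + 1` keeps the constant positive for every real `κ`.
  have hκρ : ρ⁻¹ ≤ (2 * |κ| + 1) * h⁻¹ := by
    rw [inv_le_iff_one_le_mul₀ hρ, mul_assoc, mul_comm, mul_assoc, inv_mul_eq_div, le_div_iff₀ hh]
    nlinarith [mul_le_mul_of_nonneg_right (le_abs_self κ) hρ.le]
  have hint : ∀ (s : Set E3), s ⊆ S →
      IntegrableOn (fun y => ‖polyFieldFun p y‖ ^ 2) s := fun s hs => by
    have hc : Continuous fun y => ‖polyFieldFun p y‖ ^ 2 :=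
      (continuous_polyFieldFun p).norm.pow 2
    exact (hc.continuousOn.integrableOn_compact hS.isCompact_closure).mono_set
      (hs.trans subset_closure)
  have hsub : Metric.ball z ρ ⊆ interior S :=
    interior_maximal (Metric.ball_subset_closedBall.trans hball) Metric.isOpen_ball
  have hcomp : ∀ c, polyFun (p c) x ^ 2
      ≤ K * ((ρ ^ 3)⁻¹ * ∫ y in Metric.ball z ρ, polyFun (p c) y ^ 2) := fun c => by
    let f : Fin 3 → Poly := fun j => MvPolynomial.C (z j) + MvPolynomial.C ρ * MvPolynomial.X j
    have hf : ∀ j, (f j).totalDegree ≤ 1 := fun j => by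
      refine (MvPolynomial.totalDegree_add _ _).trans (max_le (by simp) ?_)
      exact (MvPolynomial.totalDegree_mul _ _).trans (by simp [MvPolynomial.totalDegree_X])
    -- The diameter bound puts `S` inside the ball of radius `2κρ` about `z`, hence the choice `R =
    -- 2κ` after rescaling.
    have h1 := hKb (MvPolynomial.bind₁ f (p c)) (totalDegree_bind₁_le (hp c) f hf)
      (ρ⁻¹ • (x - z)) (by
        rw [mem_closedBall_zero_iff, norm_smul, Real.norm_eq_abs, abs_of_pos (inv_pos.2 hρ),
          inv_mul_le_iff₀ hρ]
        have := Metric.dist_le_diam_of_mem hS hx (hball (Metric.mem_closedBall_self hρ.le))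
        rw [dist_eq_norm] at this
        linarith)
    simp_rw [f, polyFun_bind₁_affine] at h1
    rw [smul_inv_smul₀ hρ.ne', add_sub_cancel,
      setIntegral_ball_comp_affine (fun y => polyFun (p c) y ^ 2) z hρ] at h1
    exact h1
  have hci : ∀ c, IntegrableOn (fun y => polyFun (p c) y ^ 2) (Metric.ball z ρ) := fun c => by
    have hc : Continuous fun y => polyFun (p c) y ^ 2 := (continuous_polyFun (p c)).pow 2
    exact (hc.continuousOn.integrableOn_compact (isCompact_closedBall z ρ)).mono_set
      Metric.ball_subset_closedBall
  calc ‖polyFieldFun p x‖ ^ 2 = ∑ c, polyFun (p c) x ^ 2 := norm_polyFieldFun_sq p x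
    _ ≤ ∑ c, K * ((ρ ^ 3)⁻¹ * ∫ y in Metric.ball z ρ, polyFun (p c) y ^ 2) :=
        Finset.sum_le_sum fun c _ => hcomp c
    _ = K * ρ⁻¹ ^ 3 * ∫ y in Metric.ball z ρ, ‖polyFieldFun p y‖ ^ 2 := by
        simp_rw [norm_polyFieldFun_sq]
        rw [integral_finsetSum _ fun c _ => hci c, ← Finset.mul_sum, ← Finset.mul_sum, inv_pow,
          mul_assoc]
    _ ≤ K * ((2 * |κ| + 1) * h⁻¹) ^ 3 * ∫ y in interior S, ‖polyFieldFun p y‖ ^ 2 := by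
        refine mul_le_mul (by gcongr) (setIntegral_mono_set (hint _ interior_subset)
          (Eventually.of_forall fun _ => by positivity) (LE.le.eventuallyLE hsub))
          (integral_nonneg fun _ => by positivity) (by positivity)
    _ = _ := by rw [mul_pow]; ring

/-! ### Taylor estimates for the energy density -/

theorem hasFDerivAt_gradient {f : E3 → ℝ} (hf : ContDiff ℝ 2 f) (b : E3) :
    HasFDerivAt (gradient f) (fderiv ℝ (gradient f) b) b := by
  have h1 : ContDiff ℝ 1 (fderiv ℝ f) := hf.fderiv_right (by norm_num)
  have h2 : ContDiff ℝ 1 (gradient f) :=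
    (InnerProductSpace.toDual ℝ E3).symm.contDiff.comp h1
  exact (h2.differentiable (by norm_num) b).hasFDerivAt

theorem hasDerivAt_comp_line {f : E3 → ℝ} (hf : ContDiff ℝ 2 f) (b d : E3) (t : ℝ) :
    HasDerivAt (fun t : ℝ => f (b + t • d)) (inner ℝ (gradient f (b + t • d)) d) t := by
  have h1 := ((hf.differentiable (by norm_num) (b + t • d)).hasGradientAt).hasFDerivAt
  have h2 : HasDerivAt (fun t : ℝ => b + t • d) d t := by
    simpa using ((hasDerivAt_id t).smul_const d).const_add b
  exact (h1.comp_hasDerivAt t h2).congr_deriv (by simp)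

/-- Mean value inequality on the ball of radius `‖d‖` about `b`, where the Hessian deviates from its
value at `b` by at most `M ‖d‖`. The sharp factor 1/2 is not needed. -/
theorem norm_gradient_sub_sub_le {f : E3 → ℝ} (hf : ContDiff ℝ 2 f) {M : ℝ} (hM : 0 ≤ M)
    (hL : ∀ b₁ b₂, ‖fderiv ℝ (gradient f) b₁ - fderiv ℝ (gradient f) b₂‖ ≤ M * ‖b₁ - b₂‖)
    (b d : E3) :
    ‖gradient f (b + d) - gradient f b - fderiv ℝ (gradient f) b d‖ ≤ M * ‖d‖ ^ 2 := by
  have h := (convex_closedBall b ‖d‖).norm_image_sub_le_of_norm_hasFDerivWithin_le'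
    (f := gradient f) (φ := fderiv ℝ (gradient f) b) (C := M * ‖d‖) (x := b) (y := b + d)
    (fun x _ => (hasFDerivAt_gradient hf x).hasFDerivWithinAt)
    (fun x hx => (hL x b).trans (mul_le_mul_of_nonneg_left (mem_closedBall_iff_norm.1 hx) hM))
    (Metric.mem_closedBall_self (norm_nonneg _)) (by simp)
  rw [add_sub_cancel_left] at h
  linarith

theorem taylor_upper_bound {f : E3 → ℝ} (hf : ContDiff ℝ 2 f) {M : ℝ} (hM : 0 ≤ M)
    (hL : ∀ b₁ b₂, ‖fderiv ℝ (gradient f) b₁ - fderiv ℝ (gradient f) b₂‖ ≤ M * ‖b₁ - b₂‖)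
    (b d : E3) :
    f (b + d) ≤ f b + inner ℝ (gradient f b) d
      + 1 / 2 * inner ℝ (fderiv ℝ (gradient f) b d) d + M * ‖d‖ ^ 3 := by
  set p : ℝ := inner ℝ (gradient f b) d with hp
  set q : ℝ := inner ℝ (fderiv ℝ (gradient f) b d) d with hq
  -- With the quadratic Taylor polynomial subtracted along the segment, the derivative is the
  -- gradient remainder paired with `d`, bounded by `M ‖d‖³` on `[0, 1)`.
  have hder : ∀ t : ℝ, HasDerivAt (fun t : ℝ => f (b + t • d) - (t * p + t ^ 2 / 2 * q))
      (inner ℝ (gradient f (b + t • d)) d - (p + t * q)) t := fun t => by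
    refine (hasDerivAt_comp_line hf b d t).sub ?_
    have h1 := (hasDerivAt_id t).mul_const p
    have h2 := (((hasDerivAt_id t).pow 2).div_const 2).mul_const q
    refine (h1.add h2).congr_deriv ?_
    simp
  have h := norm_image_sub_le_of_norm_deriv_le_segment_01' (C := M * ‖d‖ ^ 3)
    (fun t _ => (hder t).hasDerivWithinAt) fun t ht => by
      have h1 := norm_gradient_sub_sub_le hf hM hL b (t • d)
      have h2 : inner ℝ (gradient f (b + t • d)) d - (p + t * q)
          = inner ℝ (gradient f (b + t • d) - gradient f b
              - fderiv ℝ (gradient f) b (t • d)) d := by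
        rw [inner_sub_left, inner_sub_left, map_smul, inner_smul_left, hp, hq]
        simp; ring
      rw [h2]
      refine (norm_inner_le_norm _ _).trans ?_
      have h3 : ‖t • d‖ ≤ ‖d‖ := by
        rw [norm_smul, Real.norm_eq_abs, abs_of_nonneg ht.1]
        exact mul_le_of_le_one_left (norm_nonneg _) ht.2.le
      calc _ ≤ (M * ‖t • d‖ ^ 2) * ‖d‖ := by gcongr
        _ ≤ (M * ‖d‖ ^ 2) * ‖d‖ := by gcongr
        _ = _ := by ring
  have h' := (abs_le.1 h).2
  simp only [one_smul, zero_smul, add_zero] at h'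
  linarith

namespace Mesh

variable {Ω : Set E3} (𝒯 : Mesh Ω) (Q : QuadRule)

/-! ### Geometry of the mesh -/

theorem refMap_mem_cell (i : Fin 𝒯.N) {y : E3} (hy : y ∈ refTet) : 𝒯.refMap i y ∈ 𝒯.cell i := by
  -- Barycentric coordinates of the image point.
  let W : Fin 4 → ℝ := Fin.cons (1 - ∑ c, y c) fun c => y c
  have h : 𝒯.refMap i y = ∑ m, W m • (𝒯.tet i).points m := by
    rw [Fin.sum_univ_succ]
    simp only [W, Fin.cons_zero, Fin.cons_succ, refMap, smul_sub, Finset.sum_sub_distrib, sub_smul,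
      one_smul, Finset.sum_smul]
    abel
  rw [h]
  refine (convex_convexHull ℝ _).sum_mem (fun m _ => ?_) ?_
    fun m _ => subset_convexHull ℝ _ (Set.mem_range_self m)
  · refine Fin.cases ?_ (fun c => ?_) m
    · simpa [W] using hy.2
    · simpa [W] using hy.1 c
  · rw [Fin.sum_univ_succ]
    simp [W]

theorem cell_subset_closure (i : Fin 𝒯.N) : 𝒯.cell i ⊆ closure Ω := by
  rw [← 𝒯.cover]
  exact Set.subset_iUnion (fun i => 𝒯.cell i) i

theorem isBounded_cell (i : Fin 𝒯.N) : Bornology.IsBounded (𝒯.cell i) :=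
  ((Set.finite_range _).isCompact_convexHull ℝ).isBounded

theorem hMin_le_diam (i : Fin 𝒯.N) : 𝒯.hMin ≤ Metric.diam (𝒯.cell i) :=
  ciInf_le (Set.finite_range _).bddBelow i

/-- If two interiors met, the hull of the common vertices would have interior points, so these
vertices would span the whole space. By affine independence they would then be all the vertices of
both elements. -/
theorem disjoint_interior_cell {i j : Fin 𝒯.N} (hij : i ≠ j) :
    Disjoint (interior (𝒯.cell i)) (interior (𝒯.cell j)) := by
  by_contra h
  rw [Set.not_disjoint_iff_nonempty_inter, ← interior_inter, cell, cell, 𝒯.conforming] at h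
  have htop := affineSpan_eq_top_of_nonempty_interior h
  have hsub : ∀ (l : Fin 𝒯.N) (S : Set E3),
      affineSpan ℝ (Set.range (𝒯.tet l).points ∩ S) = ⊤ → Set.range (𝒯.tet l).points ⊆ S := by
    rintro l S hS _ ⟨m, rfl⟩
    rw [← Set.image_preimage_eq_range_inter] at hS
    exact ((𝒯.tet l).independent.mem_affineSpan_iff m _).1 (hS ▸ AffineSubspace.mem_top ℝ E3 _)
  exact 𝒯.distinct i j hij ((hsub i _ htop).antisymm (hsub j _ (Set.inter_comm _ _ ▸ htop)))

theorem glue_eq_of_mem {F : Type*} [AddCommMonoid F] (f : Fin 𝒯.N → E3 → F) {i : Fin 𝒯.N} {x : E3}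
    (hx : x ∈ interior (𝒯.cell i)) : 𝒯.glue f x = f i x := by
  rw [glue, Finset.sum_eq_single i, Set.indicator_of_mem hx]
  · intro j _ hj
    exact Set.indicator_of_notMem (fun h => (𝒯.disjoint_interior_cell hj).ne_of_mem h hx rfl) _
  · simp

theorem norm_glue_le {F : Type*} [NormedAddCommGroup F] {f : Fin 𝒯.N → E3 → F} {B : ℝ} (hB : 0 ≤ B)
    (hf : ∀ i, ∀ x ∈ 𝒯.cell i, ‖f i x‖ ≤ B) (x : E3) : ‖𝒯.glue f x‖ ≤ B := by
  by_cases h : ∃ i, x ∈ interior (𝒯.cell i)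
  · obtain ⟨i, hi⟩ := h
    rw [𝒯.glue_eq_of_mem f hi]
    exact hf i x (_root_.interior_subset hi)
  · push Not at h
    rw [glue, Finset.sum_eq_zero fun i _ => Set.indicator_of_notMem (h i) _, norm_zero]
    exact hB

/-! ### Quadrature and discrete norms -/

variable {𝒯 Q} {k : ℕ}

/-- Positive weights and points in the closed elements make the quadrature a positive functional;
all energy estimates below are pointwise inequalities summed in this way. -/
theorem quad_mono (hQ : 𝒯.IsAdmissibleRule Q k) {f g : Fin 𝒯.N → E3 → ℝ}
    (hfg : ∀ i, ∀ x ∈ 𝒯.cell i, f i x ≤ g i x) : 𝒯.quad Q f ≤ 𝒯.quad Q g := by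
  refine Finset.sum_le_sum fun i _ => Finset.sum_le_sum fun j _ => ?_
  have h := hfg i _ (𝒯.refMap_mem_cell i (hQ.mem_refTet j))
  have h1 := (hQ.wt_pos j).le
  have h2 : 0 ≤ 𝒯.cellVol i := ENNReal.toReal_nonneg
  gcongr

theorem curlOn_add (u v : 𝒯.PwField) (i : Fin 𝒯.N) (x : E3) :
    𝒯.curlOn (u + v) i x = 𝒯.curlOn u i x + 𝒯.curlOn v i x := by
  simp [curlOn, polyCurl_add, polyFieldFun_add]

theorem curlOn_smul (t : ℝ) (v : 𝒯.PwField) (i : Fin 𝒯.N) (x : E3) :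
    𝒯.curlOn (t • v) i x = t • 𝒯.curlOn v i x := by
  simp [curlOn, polyCurl_smul, polyFieldFun_smul]

theorem curlOn_sub (u v : 𝒯.PwField) (i : Fin 𝒯.N) (x : E3) :
    𝒯.curlOn (u - v) i x = 𝒯.curlOn u i x - 𝒯.curlOn v i x := by
  rw [eq_sub_iff_add_eq, ← curlOn_add, sub_add_cancel]

theorem innerH_self_eq (hQ : 𝒯.IsAdmissibleRule Q k) {u : 𝒯.PwField} (hu : 𝒯.IsPwDegreeLE k u) :
    𝒯.quad Q (fun i x => ‖polyFieldFun (u i) x‖ ^ 2) = l2Norm Ω (𝒯.fieldFun u) ^ 2 := by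
  have h := hQ.exact u u hu hu
  simp only [innerH, real_inner_self_eq_norm_sq] at h
  rw [h, l2Norm, Real.sq_sqrt (integral_nonneg fun _ => by positivity)]

theorem setIntegral_interior_cell_le (hQ : 𝒯.IsAdmissibleRule Q k) {u : 𝒯.PwField}
    (hu : 𝒯.IsPwDegreeLE k u) (i : Fin 𝒯.N) :
    ∫ x in interior (𝒯.cell i), ‖polyFieldFun (u i) x‖ ^ 2 ≤ l2Norm Ω (𝒯.fieldFun u) ^ 2 := by
  -- The space `P_k(𝒯)³` imposes no continuity, so `u` cut off to one element stays in it. Exactness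
  -- reduces the comparison of integrals to monotonicity of the quadrature.
  let v : 𝒯.PwField := Pi.single i (u i)
  have hvi : v i = u i := Pi.single_eq_same _ _
  have hvj : ∀ j ≠ i, v j = 0 := fun j hj => Pi.single_eq_of_ne hj _
  have hv : 𝒯.IsPwDegreeLE k v := fun j c => by
    by_cases hj : j = i
    · subst hj; rw [hvi]; exact hu j c
    · rw [hvj j hj]; simp
  have h1 : ∫ x in interior (𝒯.cell i), ‖polyFieldFun (u i) x‖ ^ 2
      = l2Norm Ω (𝒯.fieldFun v) ^ 2 := by
    rw [l2Norm, Real.sq_sqrt (integral_nonneg fun _ => by positivity)]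
    have h2 : ∀ x, ‖𝒯.fieldFun v x‖ ^ 2
        = (interior (𝒯.cell i)).indicator (fun x => ‖polyFieldFun (u i) x‖ ^ 2) x := fun x => by
      rw [fieldFun, glue, Finset.sum_eq_single i]
      · by_cases hx : x ∈ interior (𝒯.cell i)
        · simp [hx, hvi]
        · simp [hx]
      · intro j _ hj
        refine Set.indicator_apply_eq_zero.2 fun _ => ?_
        rw [hvj j hj, polyFieldFun_zero]
      · simp
    simp_rw [h2]
    rw [setIntegral_indicator isOpen_interior.measurableSet,
      show Ω ∩ interior (𝒯.cell i) = _ from Set.inter_eq_right.2 (𝒯.interior_subset i)]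
  rw [h1, ← innerH_self_eq hQ hv, ← innerH_self_eq hQ hu]
  refine quad_mono hQ fun j x _ => ?_
  by_cases hj : j = i
  · subst hj; rw [hvi]
  · rw [hvj j hj, polyFieldFun_zero]; simp

theorem quad_norm_curlOn_sq (hQ : 𝒯.IsAdmissibleRule Q k) {v : 𝒯.PwField}
    (hv : ∀ i, IsNedelec k (v i)) :
    𝒯.quad Q (fun i x => ‖𝒯.curlOn v i x‖ ^ 2) = l2Norm Ω (𝒯.curlFun v) ^ 2 :=
  innerH_self_eq hQ fun i => (hv i).totalDegree_polyCurl_le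

/-- Inverse estimate for curls of Nédélec fields on meshes with minimal element size `h`. -/
theorem exists_norm_curlOn_le (k : ℕ) (κ : ℝ) :
    ∃ C : ℝ, 0 < C ∧ ∀ {Ω : Set E3} {𝒯 : Mesh Ω} {Q : QuadRule} {h : ℝ}, 0 < h →
      𝒯.IsShapeRegular κ → 𝒯.hMin = h → 𝒯.IsAdmissibleRule Q k →
      ∀ v : 𝒯.PwField, (∀ i, IsNedelec k (v i)) → ∀ i, ∀ x ∈ 𝒯.cell i,
        ‖𝒯.curlOn v i x‖ ≤ C * h ^ (-(3 / 2) : ℝ) * l2Norm Ω (𝒯.curlFun v) := by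
  obtain ⟨K, hK, hKb⟩ := exists_inverse_estimate k κ
  refine ⟨Real.sqrt K, Real.sqrt_pos.2 hK, ?_⟩
  intro Ω 𝒯 Q h hh hκ hhm hQ v hv i x hx
  obtain ⟨z, ρ, hρ, hball, hdiam⟩ := hκ i
  have hdeg : 𝒯.IsPwDegreeLE k (𝒯.pwCurl v) := fun i => (hv i).totalDegree_polyCurl_le
  have h1 := hKb (𝒯.cell i) z ρ h (𝒯.isBounded_cell i) hρ hh hball hdiam
    (hhm ▸ 𝒯.hMin_le_diam i) (polyCurl (v i)) (hdeg i) x hx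
  have h2 := setIntegral_interior_cell_le hQ hdeg i
  have hH : (h ^ (-(3 / 2) : ℝ)) ^ 2 = h⁻¹ ^ 3 := by
    rw [← Real.rpow_natCast, ← Real.rpow_mul hh.le, inv_pow, ← Real.rpow_natCast h 3,
      ← Real.rpow_neg hh.le]
    norm_num
  have hl : 0 ≤ l2Norm Ω (𝒯.curlFun v) := Real.sqrt_nonneg _
  refine abs_le_of_sq_le_sq' ?_ (by positivity) |>.2
  rw [mul_pow, mul_pow, Real.sq_sqrt hK.le, hH]
  exact h1.trans (mul_le_mul_of_nonneg_left h2 (by positivity))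

theorem linftyNorm_curlFun_le {v : 𝒯.PwField} {B : ℝ} (hB : 0 ≤ B)
    (hv : ∀ i, ∀ x ∈ 𝒯.cell i, ‖𝒯.curlOn v i x‖ ≤ B) :
    linftyNorm Ω (𝒯.curlFun v) ≤ ENNReal.ofReal B := by
  rw [linftyNorm, eLpNorm_exponent_top]
  exact eLpNormEssSup_le_of_ae_bound (Eventually.of_forall fun x => 𝒯.norm_glue_le hB hv x)

theorem l2Norm_le_of_linftyNorm_le {Ω : Set E3} (hΩ : Bornology.IsBounded Ω) {F : Type*}
    [NormedAddCommGroup F] {f : E3 → F} {B : ℝ} (hB : 0 ≤ B)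
    (hf : linftyNorm Ω f ≤ ENNReal.ofReal B) :
    l2Norm Ω f ≤ Real.sqrt (volume.real Ω) * B := by
  have hfin : volume Ω ≠ ⊤ := hΩ.measure_lt_top.ne
  have : IsFiniteMeasure (volume.restrict Ω) := ⟨by simpa using hfin.lt_top⟩
  rw [← Real.sqrt_sq hB, ← Real.sqrt_mul measureReal_nonneg]
  refine Real.sqrt_le_sqrt ?_
  have hae : ∀ᵐ x ∂volume.restrict Ω, ‖f x‖ ≤ B := by
    rw [linftyNorm, eLpNorm_exponent_top] at hf
    filter_upwards [ae_le_eLpNormEssSup (f := f) (μ := volume.restrict Ω)] with x hx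
    have := hx.trans hf
    rw [← ofReal_norm] at this
    exact (ENNReal.ofReal_le_ofReal_iff hB).1 this
  calc ∫ x in Ω, ‖f x‖ ^ 2 ≤ ∫ _ in Ω, B ^ 2 := by
        -- Only the constant majorant has to be integrable; no measurability of `f` enters.
        refine integral_mono_of_nonneg (Eventually.of_forall fun _ => by positivity)
          (integrable_const _) ?_
        filter_upwards [hae] with x hx
        gcongr
    _ = volume.real Ω * B ^ 2 := by simp

theorem zero_mem_lagrangeSpace (k : ℕ) : (0 : Fin 𝒯.N → Poly) ∈ 𝒯.lagrangeSpace k := by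
  have h0 : (𝒯.glue fun i => polyFun ((0 : Fin 𝒯.N → Poly) i)) = fun _ => 0 := by
    ext x
    refine Finset.sum_eq_zero fun i _ => Set.indicator_apply_eq_zero.2 fun _ => ?_
    simp [polyFun]
  refine ⟨fun i => by simp, ?_⟩
  rw [h0]
  refine ⟨MemLp.zero', fun _ _ => 0, fun i => ⟨MemLp.zero', fun φ _ => by simp⟩, fun ε hε => ?_⟩
  refine ⟨fun _ => 0, ⟨contDiff_const, HasCompactSupport.zero, by simp [tsupport]⟩, ?_, fun i => ?_⟩
  · simpa [l2Norm] using hε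
  · simpa [l2Norm, partialDeriv] using hε

theorem IsStableComplement.isNedelec {V : Submodule ℝ 𝒯.PwField} (hV : 𝒯.IsStableComplement k V)
    {v : 𝒯.PwField} (hv : v ∈ V) (i : Fin 𝒯.N) : IsNedelec k (v i) := by
  have h : v ∈ 𝒯.nedelecSpace k := by
    rw [hV.sum]
    refine ⟨0, zero_mem_lagrangeSpace k, v, hv, ?_⟩
    have : 𝒯.pwGrad 0 = 0 := by ext1 i; ext1 c; simp [pwGrad, polyGrad]
    rw [this, zero_add]
  exact h.1 i

/-! ### The Newton step -/

variable {w : E3 → E3 → ℝ} {hs : Fin 𝒯.N → E3 → E3} {V : Submodule ℝ 𝒯.PwField}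
  {γ L M σ ρ s : ℝ} {a ah δ : 𝒯.PwField}

/-- The residual is the derivative at `t = 0` of the energy along `ah + t • v`, a line in `V` on
which the minimum is attained at `t = 0`. -/
theorem residual_eq_zero (hQ : 𝒯.IsAdmissibleRule Q k) (hw : IsAdmissibleEnergy Ω γ L w)
    (hah : 𝒯.IsDiscreteSolution Q w hs V ah) {v : 𝒯.PwField} (hv : v ∈ V) :
    𝒯.residual Q w hs ah v = 0 := by
  have hE : (fun t : ℝ => 𝒯.energy Q w hs (ah + t • v)) = fun t : ℝ => ∑ i, ∑ j,
      (w (𝒯.refMap i (Q.pt j)) (𝒯.curlOn ah i (𝒯.refMap i (Q.pt j))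
          + t • 𝒯.curlOn v i (𝒯.refMap i (Q.pt j)))
        - (inner ℝ (hs i (𝒯.refMap i (Q.pt j))) (𝒯.curlOn ah i (𝒯.refMap i (Q.pt j)))
          + t * inner ℝ (hs i (𝒯.refMap i (Q.pt j))) (𝒯.curlOn v i (𝒯.refMap i (Q.pt j)))))
        * Q.wt j * 𝒯.cellVol i := by
    ext t
    simp only [energy, innerH, quad, ← Finset.sum_sub_distrib, curlOn_add, curlOn_smul,
      inner_add_right, inner_smul_right]
    exact Finset.sum_congr rfl fun i _ => Finset.sum_congr rfl fun j _ => by ring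
  have hder : HasDerivAt (fun t : ℝ => 𝒯.energy Q w hs (ah + t • v))
      (𝒯.residual Q w hs ah v) 0 := by
    rw [hE, residual, innerH, quad]
    refine HasDerivAt.fun_sum fun i _ => HasDerivAt.fun_sum fun j _ => ?_
    refine ((HasDerivAt.sub (hasDerivAt_comp_line (hw.contDiff _ ?_) _ _ 0)
      (((hasDerivAt_id (0 : ℝ)).mul_const _).const_add _)).congr_deriv ?_
        |>.mul_const _ |>.mul_const _)
    · exact 𝒯.cell_subset_closure i (𝒯.refMap_mem_cell i (hQ.mem_refTet j))
    · simp [inner_sub_left, dw]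
  refine IsLocalMin.hasDerivAt_eq_zero (Eventually.of_forall fun t => ?_) hder
  simpa using hah.2 _ (V.add_mem hah.1 (V.smul_mem t hv))

theorem l2Norm_newton_error_le (hγ : 0 < γ) (hM : 0 ≤ M) (hQ : 𝒯.IsAdmissibleRule Q k)
    (hV : 𝒯.IsStableComplement k V) (hw : IsAdmissibleEnergy Ω γ L w)
    (hwM : HasLipschitzHessian Ω M w) (hah : 𝒯.IsDiscreteSolution Q w hs V ah) (ha : a ∈ V)
    (hδ : 𝒯.IsNewtonIncrement Q w hs V a δ) (hs0 : 0 ≤ s)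
    (hs' : ∀ i, ∀ x ∈ 𝒯.cell i, ‖𝒯.curlOn (a - ah) i x‖ ≤ s) :
    l2Norm Ω (𝒯.curlFun (a + δ - ah)) ≤ M / γ * s * l2Norm Ω (𝒯.curlFun (a - ah)) := by
  have he : a - ah ∈ V := V.sub_mem ha hah.1
  have hv : a + δ - ah ∈ V := V.sub_mem (V.add_mem ha hδ.1) hah.1
  have h1 := hδ.2 _ hv
  have h2 := residual_eq_zero hQ hw hah hv
  set v := a + δ - ah with hvdef
  -- Newton equation minus optimality condition, both tested with the new error `v`; the source
  -- cancels.
  have hzero : 𝒯.quad Q (fun i x =>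
      inner ℝ (ddw w x (𝒯.curlOn a i x) (𝒯.curlOn δ i x)) (𝒯.curlOn v i x)
      + inner ℝ (dw w x (𝒯.curlOn a i x) - hs i x) (𝒯.curlOn v i x)
      - inner ℝ (dw w x (𝒯.curlOn ah i x) - hs i x) (𝒯.curlOn v i x)) = 0 := by
    simp only [residual, innerH, quad] at h1 h2
    simp only [quad, sub_mul, add_mul, Finset.sum_sub_distrib, Finset.sum_add_distrib]
    linarith
  have hquad : 𝒯.quad Q (fun i x => γ / 2 * ‖𝒯.curlOn v i x‖ ^ 2
        - (M * s) ^ 2 / (2 * γ) * ‖𝒯.curlOn (a - ah) i x‖ ^ 2)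
      = γ / 2 * l2Norm Ω (𝒯.curlFun v) ^ 2
        - (M * s) ^ 2 / (2 * γ) * l2Norm Ω (𝒯.curlFun (a - ah)) ^ 2 := by
    rw [← quad_norm_curlOn_sq hQ fun i => hV.isNedelec hv i,
      ← quad_norm_curlOn_sq hQ fun i => hV.isNedelec he i]
    simp only [quad, sub_mul, Finset.sum_sub_distrib, Finset.mul_sum, mul_assoc]
  have hle : γ / 2 * l2Norm Ω (𝒯.curlFun v) ^ 2
        - (M * s) ^ 2 / (2 * γ) * l2Norm Ω (𝒯.curlFun (a - ah)) ^ 2 ≤ 0 := by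
    rw [← hquad, ← hzero]
    refine quad_mono hQ fun i x hx => ?_
    have hxΩ := 𝒯.cell_subset_closure i hx
    -- Taylor expansion at `curl a` towards `curl ah`; the remainder is `R` below.
    have ht := norm_gradient_sub_sub_le (hw.contDiff x hxΩ) hM (hwM x hxΩ) (𝒯.curlOn a i x)
      (-𝒯.curlOn (a - ah) i x)
    have hlow := hw.lower x hxΩ (𝒯.curlOn a i x) (𝒯.curlOn v i x)
    have hes := hs' i x hx
    have hδv : 𝒯.curlOn δ i x = 𝒯.curlOn v i x - 𝒯.curlOn (a - ah) i x := by
      rw [← curlOn_sub, hvdef]; congr 1; abel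
    have hah' : 𝒯.curlOn a i x + -𝒯.curlOn (a - ah) i x = 𝒯.curlOn ah i x := by
      rw [curlOn_sub]; abel
    rw [hah', norm_neg, map_neg, sub_neg_eq_add] at ht
    rw [hδv, map_sub]
    set E := 𝒯.curlOn (a - ah) i x
    set B := 𝒯.curlOn v i x
    set R := gradient (w x) (𝒯.curlOn ah i x) - gradient (w x) (𝒯.curlOn a i x)
      + fderiv ℝ (gradient (w x)) (𝒯.curlOn a i x) E with hR
    have hsplit : inner ℝ (ddw w x (𝒯.curlOn a i x) B - ddw w x (𝒯.curlOn a i x) E) B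
        + inner ℝ (dw w x (𝒯.curlOn a i x) - hs i x) B
        - inner ℝ (dw w x (𝒯.curlOn ah i x) - hs i x) B
        = inner ℝ (ddw w x (𝒯.curlOn a i x) B) B - inner ℝ R B := by
      rw [hR]
      simp only [inner_sub_left, inner_add_left, dw, ddw]
      ring
    rw [hsplit]
    have hRB : inner ℝ R B ≤ M * s * ‖E‖ * ‖B‖ := by
      refine (real_inner_le_norm _ _).trans (mul_le_mul_of_nonneg_right (ht.trans ?_)
        (norm_nonneg _))
      have := mul_le_mul_of_nonneg_left hes (mul_nonneg hM (norm_nonneg E))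
      linarith
    -- Young's inequality leaves only squares, on which the quadrature is exact. This weight absorbs
    -- half of the coercive term and loses nothing in the constant `M / γ`.
    have hyoung : M * s * ‖E‖ * ‖B‖ ≤ γ / 2 * ‖B‖ ^ 2 + (M * s) ^ 2 / (2 * γ) * ‖E‖ ^ 2 := by
      have : γ / 2 * ‖B‖ ^ 2 + (M * s) ^ 2 / (2 * γ) * ‖E‖ ^ 2 - M * s * ‖E‖ * ‖B‖
          = (γ * ‖B‖ - M * s * ‖E‖) ^ 2 / (2 * γ) := by field_simp; ring
      have h0 : 0 ≤ (γ * ‖B‖ - M * s * ‖E‖) ^ 2 / (2 * γ) := by positivity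
      linarith
    linarith
  have hl : 0 ≤ l2Norm Ω (𝒯.curlFun (a - ah)) := Real.sqrt_nonneg _
  refine (abs_le_of_sq_le_sq' ?_ (by positivity)).2
  have : (M / γ * s * l2Norm Ω (𝒯.curlFun (a - ah))) ^ 2
      = (M * s) ^ 2 / (2 * γ) * l2Norm Ω (𝒯.curlFun (a - ah)) ^ 2 * (2 / γ) := by
    field_simp
  rw [this, ← div_le_iff₀ (by positivity)]
  have : l2Norm Ω (𝒯.curlFun v) ^ 2 / (2 / γ) = γ / 2 * l2Norm Ω (𝒯.curlFun v) ^ 2 := by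
    field_simp
  linarith

/-- Since `⟨H curl δ, curl δ⟩_h = -residual`, the Armijo defect is the quadrature of a second-order
Taylor expression. Pointwise it is at most `-(1/2 - σ) γ |curl δ|² + M |curl δ|³`, which is
nonpositive for small `curl δ`. -/
theorem armijo_full_step (hσ : σ < 1 / 2) (hM : 0 ≤ M) (hQ : 𝒯.IsAdmissibleRule Q k)
    (hw : IsAdmissibleEnergy Ω γ L w) (hwM : HasLipschitzHessian Ω M w)
    (hδ : 𝒯.IsNewtonIncrement Q w hs V a δ)
    (hs' : ∀ i, ∀ x ∈ 𝒯.cell i, M * ‖𝒯.curlOn δ i x‖ ≤ γ * (1 / 2 - σ)) :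
    𝒯.energy Q w hs (a + δ) ≤ 𝒯.energy Q w hs a + σ * 𝒯.residual Q w hs a δ := by
  have h1 := hδ.2 δ hδ.1
  -- The subtracted multiple of `1 - σ` vanishes by the Newton equation; it trades the residual for
  -- the Hessian form.
  have heq : 𝒯.energy Q w hs (a + δ) - 𝒯.energy Q w hs a - σ * 𝒯.residual Q w hs a δ
      - (1 - σ) * (𝒯.innerH Q (fun i x => ddw w x (𝒯.curlOn a i x) (𝒯.curlOn δ i x)) (𝒯.curlOn δ)
        + 𝒯.residual Q w hs a δ)
      = 𝒯.quad Q (fun i x => w x (𝒯.curlOn a i x + 𝒯.curlOn δ i x) - w x (𝒯.curlOn a i x)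
        - inner ℝ (dw w x (𝒯.curlOn a i x)) (𝒯.curlOn δ i x)
        - (1 - σ) * inner ℝ (ddw w x (𝒯.curlOn a i x) (𝒯.curlOn δ i x)) (𝒯.curlOn δ i x)) := by
    simp only [energy, residual, innerH, quad, curlOn_add, inner_add_right, inner_sub_left,
      Finset.mul_sum, ← Finset.sum_sub_distrib, ← Finset.sum_add_distrib]
    exact Finset.sum_congr rfl fun i _ => Finset.sum_congr rfl fun j _ => by ring
  rw [h1, neg_add_cancel, mul_zero, sub_zero] at heq
  have hle := quad_mono hQ (f := fun i x => w x (𝒯.curlOn a i x + 𝒯.curlOn δ i x)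
        - w x (𝒯.curlOn a i x)
        - inner ℝ (dw w x (𝒯.curlOn a i x)) (𝒯.curlOn δ i x)
        - (1 - σ) * inner ℝ (ddw w x (𝒯.curlOn a i x) (𝒯.curlOn δ i x)) (𝒯.curlOn δ i x))
      (g := fun _ _ => 0) fun i x hx => by
    have hxΩ := 𝒯.cell_subset_closure i hx
    have ht := taylor_upper_bound (hw.contDiff x hxΩ) hM (hwM x hxΩ) (𝒯.curlOn a i x)
      (𝒯.curlOn δ i x)
    have hlow := hw.lower x hxΩ (𝒯.curlOn a i x) (𝒯.curlOn δ i x)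
    have h3 := mul_le_mul_of_nonneg_right (hs' i x hx) (sq_nonneg ‖𝒯.curlOn δ i x‖)
    have h4 := mul_le_mul_of_nonneg_left hlow (sub_nonneg.2 hσ.le)
    simp only [dw, ddw] at *
    linarith
  have h0 : 𝒯.quad Q (fun _ _ => 0) = 0 := by simp [quad]
  linarith

theorem IsArmijoStep.eq_one {τ : ℝ} (hρ : 0 < ρ) (hρ1 : ρ ≤ 1)
    (hτ : 𝒯.IsArmijoStep Q w hs ρ σ a δ τ)
    (h : 𝒯.energy Q w hs (a + δ) ≤ 𝒯.energy Q w hs a + σ * 𝒯.residual Q w hs a δ) : τ = 1 := by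
  obtain ⟨⟨⟨m, rfl⟩, -⟩, hmax⟩ := hτ
  exact le_antisymm (pow_le_one₀ hρ.le hρ1) (hmax ⟨⟨0, by simp⟩, by simpa using h⟩)

end Mesh

/-- A radius that satisfies the finitely many smallness conditions of the local analysis. -/
theorem exists_convergence_radius {γ M σ c A : ℝ} (hγ : 0 < γ) (hσ : σ < 1 / 2) :
    ∃ r : ℝ, 0 < r ∧ M / γ * c * (A * r) ≤ 1 / 2 ∧ c * (A * (M / γ * c * (A * r))) ≤ 1 ∧
      M * (2 * (c * (A * r))) ≤ γ * (1 / 2 - σ) := by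
  -- Each condition is linear in `r` with a positive right-hand side.
  have hev : ∀ B b : ℝ, 0 < b → ∀ᶠ r in 𝓝[>] (0 : ℝ), B * r ≤ b := fun B b hb => by
    have h : Tendsto (fun r : ℝ => B * r) (𝓝[>] 0) (𝓝 0) := by
      have : Continuous fun r : ℝ => B * r := by fun_prop
      simpa using (this.tendsto 0).mono_left nhdsWithin_le_nhds
    exact (h.eventually_lt_const hb).mono fun _ => le_of_lt
  obtain ⟨r, ⟨⟨h1, h2⟩, h3⟩, hr⟩ := (((hev (M / γ * c * A) (1 / 2) (by norm_num)).and
    (hev (c * (A * (M / γ * c * A))) 1 one_pos)).and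
    (hev (M * (2 * (c * A))) (γ * (1 / 2 - σ)) (mul_pos hγ (by linarith)))).and
    self_mem_nhdsWithin |>.exists
  exact ⟨r, hr, by linarith, by linarith, by linarith⟩

/-! ### Damped Newton iterates near the minimizer -/

namespace Mesh

variable {Ω : Set E3} {𝒯 : Mesh Ω} {Q : QuadRule} {k : ℕ} {w : E3 → E3 → ℝ}
  {hs : Fin 𝒯.N → E3 → E3} {V : Submodule ℝ 𝒯.PwField} {γ L M σ ρ c : ℝ} {ah : 𝒯.PwField}
  {a δ : ℕ → 𝒯.PwField} {τ : ℕ → ℝ}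

theorem IsDampedNewton.mem (h : 𝒯.IsDampedNewton Q w hs V ρ σ a δ τ) (n : ℕ) : a n ∈ V := by
  induction n with
  | zero => exact h.init
  | succ n ih => rw [h.update]; exact V.add_mem ih (V.smul_mem _ (h.increment n).1)

/-- One step of the damped Newton method close to the solution. -/
theorem IsDampedNewton.full_step (hγ : 0 < γ) (hM : 0 ≤ M) (hρ : 0 < ρ) (hρ1 : ρ ≤ 1)
    (hσ : σ < 1 / 2) (hQ : 𝒯.IsAdmissibleRule Q k) (hV : 𝒯.IsStableComplement k V)
    (hw : IsAdmissibleEnergy Ω γ L w) (hwM : HasLipschitzHessian Ω M w)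
    (hah : 𝒯.IsDiscreteSolution Q w hs V ah) (hN : 𝒯.IsDampedNewton Q w hs V ρ σ a δ τ)
    (hc : 0 ≤ c) (hinv : ∀ v : 𝒯.PwField, (∀ i, IsNedelec k (v i)) → ∀ i, ∀ x ∈ 𝒯.cell i,
      ‖𝒯.curlOn v i x‖ ≤ c * l2Norm Ω (𝒯.curlFun v)) {n : ℕ} {R : ℝ}
    (hR : l2Norm Ω (𝒯.curlFun (a n - ah)) ≤ R) (hR1 : M / γ * c * R ≤ 1 / 2)
    (hR2 : M * (2 * (c * R)) ≤ γ * (1 / 2 - σ)) :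
    τ n = 1 ∧ l2Norm Ω (𝒯.curlFun (a (n + 1) - ah))
      ≤ M / γ * c * l2Norm Ω (𝒯.curlFun (a n - ah)) ^ 2 := by
  have hned : ∀ v ∈ V, ∀ i, IsNedelec k (v i) := fun v hv i => hV.isNedelec hv i
  have hl : 0 ≤ l2Norm Ω (𝒯.curlFun (a n - ah)) := Real.sqrt_nonneg _
  have he : a n - ah ∈ V := V.sub_mem (hN.mem n) hah.1
  have hv : a n + δ n - ah ∈ V := V.sub_mem (V.add_mem (hN.mem n) (hN.increment n).1) hah.1
  have hcR := mul_le_mul_of_nonneg_left hR hc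
  have hMγ : 0 ≤ M / γ := by positivity
  have hquad := l2Norm_newton_error_le hγ hM hQ hV hw hwM hah (hN.mem n) (hN.increment n)
    (mul_nonneg hc hl) (hinv _ (hned _ he))
  -- This concerns the hypothetical full step, so it can be used to prove that the full step is
  -- accepted.
  have hcontr : l2Norm Ω (𝒯.curlFun (a n + δ n - ah)) ≤ R := by
    have h1 : M / γ * (c * l2Norm Ω (𝒯.curlFun (a n - ah))) ≤ 1 / 2 := by
      have := mul_le_mul_of_nonneg_left hcR hMγ
      linarith
    have h2 := mul_le_mul_of_nonneg_right h1 hl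
    linarith
  have hτ : τ n = 1 := by
    refine (hN.step n).eq_one hρ hρ1 (armijo_full_step hσ hM hQ hw hwM (hN.increment n) ?_)
    intro i x hx
    have h1 := hinv _ (hned _ he) i x hx
    have h2 := hinv _ (hned _ hv) i x hx
    have h3 := mul_le_mul_of_nonneg_left hcontr hc
    -- The increment is the difference of the new and the old error, each at most `c * R` pointwise;
    -- hence the factor 2.
    have hδ : 𝒯.curlOn (δ n) i x
        = 𝒯.curlOn (a n + δ n - ah) i x - 𝒯.curlOn (a n - ah) i x := by
      rw [← curlOn_sub]; congr 1; abel
    refine (mul_le_mul_of_nonneg_left (?_ : _ ≤ 2 * (c * R)) hM).trans hR2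
    rw [hδ]
    exact (norm_sub_le _ _).trans (by linarith)
  refine ⟨hτ, ?_⟩
  rw [hN.update, hτ, one_smul]
  linarith

end Mesh

end Magnetostatics

theorem theorem5 (k : ℕ) (κ : ℝ) :
    ∃ C : ℝ, 0 < C ∧
      ∀ (Ω : Set Magnetostatics.E3), Magnetostatics.IsAdmissibleDomain Ω →
      ∀ (γ L M ρ σ h : ℝ), 0 < γ → 0 < L → 0 ≤ M → 0 < ρ → ρ ≤ 1 / 2 → 0 < σ → σ < 1 / 2 →
        0 < h →
      ∃ r : ℝ, 0 < r ∧
        ∀ (𝒯 : Magnetostatics.Mesh Ω) (Q : Magnetostatics.QuadRule)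
          (w : Magnetostatics.E3 → Magnetostatics.E3 → ℝ)
          (hs : Fin 𝒯.N → Magnetostatics.E3 → Magnetostatics.E3)
          (V : Submodule ℝ 𝒯.PwField) (ah : 𝒯.PwField)
          (a δ : ℕ → 𝒯.PwField) (τ : ℕ → ℝ),
          𝒯.IsShapeRegular κ → 𝒯.hMin = h →
          𝒯.IsAdmissibleRule Q k →
          𝒯.IsStableComplement k V →
          𝒯.IsSource hs →
          Magnetostatics.IsAdmissibleEnergy Ω γ L w →
          Magnetostatics.HasLipschitzHessian Ω M w →
          𝒯.IsDiscreteSolution Q w hs V ah →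
          𝒯.IsDampedNewton Q w hs V ρ σ a δ τ →
          ∀ n : ℕ,
            Magnetostatics.linftyNorm Ω (𝒯.curlFun (a n - ah)) ≤ ENNReal.ofReal r →
            (τ n = 1 ∧
              Magnetostatics.l2Norm Ω (𝒯.curlFun (a (n + 1) - ah))
                ≤ C * (M / γ) * h ^ (-(3 / 2) : ℝ)
                    * Magnetostatics.l2Norm Ω (𝒯.curlFun (a n - ah)) ^ 2) ∧
            (∀ m ≥ n,
              Magnetostatics.linftyNorm Ω (𝒯.curlFun (a m - ah)) ≤ ENNReal.ofReal r) ∧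
            Tendsto (fun m => Magnetostatics.l2Norm Ω (𝒯.curlFun (a m - ah))) atTop (𝓝 0) := by
  obtain ⟨C, hC, hinv⟩ := Magnetostatics.Mesh.exists_norm_curlOn_le k κ
  refine ⟨C, hC, ?_⟩
  intro Ω hΩ γ L M ρ σ h hγ _ hM hρ hρ2 _ hσ hh
  have hc : 0 ≤ C * h ^ (-(3 / 2) : ℝ) := by positivity
  -- `A * r` bounds the `L²` error on the `L^∞` ball. The three conditions give contraction by 1/2,
  -- invariance of the ball, and acceptance of the full step.
  obtain ⟨r, hr, hr1, hr2, hr3⟩ := Magnetostatics.exists_convergence_radius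
    (M := M) (c := C * h ^ (-(3 / 2) : ℝ)) (A := Real.sqrt (volume.real Ω)) hγ hσ
  refine ⟨r, hr, ?_⟩
  intro 𝒯 Q w hs V ah a δ τ hκ hmin hQ hV _ hw hwM hah hN n hn
  set c := C * h ^ (-(3 / 2) : ℝ) with hcdef
  set A := Real.sqrt (volume.real Ω)
  set e : ℕ → ℝ := fun m => Magnetostatics.l2Norm Ω (𝒯.curlFun (a m - ah)) with he
  have he0 : ∀ m, 0 ≤ e m := fun m => Real.sqrt_nonneg _
  have hMγ : 0 ≤ M / γ := by positivity
  have hinv' := hinv hh hκ hmin hQ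
  have hl2 : ∀ m, Magnetostatics.linftyNorm Ω (𝒯.curlFun (a m - ah)) ≤ ENNReal.ofReal r →
      e m ≤ A * r := fun m hm =>
    Magnetostatics.Mesh.l2Norm_le_of_linftyNorm_le hΩ.isBounded hr.le hm
  have hfull : ∀ m, Magnetostatics.linftyNorm Ω (𝒯.curlFun (a m - ah)) ≤ ENNReal.ofReal r →
      τ m = 1 ∧ e (m + 1) ≤ M / γ * c * e m ^ 2 := fun m hm =>
    hN.full_step hγ hM hρ (by linarith) hσ hQ hV hw hwM hah hc hinv' (hl2 m hm) hr1 hr3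
  have hhalf : ∀ m, Magnetostatics.linftyNorm Ω (𝒯.curlFun (a m - ah)) ≤ ENNReal.ofReal r →
      e (m + 1) ≤ M / γ * c * (A * r) * e m := fun m hm => by
    refine (hfull m hm).2.trans ?_
    have := mul_le_mul_of_nonneg_right
      (mul_le_mul_of_nonneg_left (hl2 m hm) (mul_nonneg hMγ hc)) (he0 m)
    linarith
  have hpers : ∀ m ≥ n,
      Magnetostatics.linftyNorm Ω (𝒯.curlFun (a m - ah)) ≤ ENNReal.ofReal r := fun m hm => by
    induction m, hm using Nat.le_induction with
    | base => exact hn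
    | succ m _ ih =>
      -- Contraction in `L²` alone does not keep the iterate in the `L^∞` ball, because returning to
      -- `L^∞` costs `c * A`; `hr2` compensates for this.
      refine Magnetostatics.Mesh.linftyNorm_curlFun_le hr.le fun i x hx => ?_
      refine (hinv' _ (fun i => hV.isNedelec (V.sub_mem (hN.mem _) hah.1) i) i x hx).trans ?_
      have h1 := mul_le_mul_of_nonneg_left (hl2 m ih)
        (by positivity : 0 ≤ M / γ * c * (A * r))
      have h2 := mul_le_mul_of_nonneg_left ((hhalf m ih).trans h1) hc
      have h3 := mul_le_mul_of_nonneg_right hr2 hr.le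
      exact h2.trans (by linarith)
  refine ⟨⟨(hfull n hn).1, (hfull n hn).2.trans_eq (by rw [hcdef]; ring)⟩, hpers, ?_⟩
  -- For convergence the linear rate 1/2 suffices.
  have hgeom : ∀ j, e (j + n) ≤ (1 / 2) ^ j * e n := fun j => by
    induction j with
    | zero => simp
    | succ j ih =>
      rw [add_right_comm, pow_succ]
      have h1 := hhalf (j + n) (hpers _ (Nat.le_add_left _ _))
      have h2 := mul_le_mul_of_nonneg_right hr1 (he0 (j + n))
      linarith
  rw [← tendsto_add_atTop_iff_nat n]
  refine squeeze_zero (fun j => he0 _) hgeom ?_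
  simpa using (tendsto_pow_atTop_nhds_zero_of_lt_one (by norm_num : (0 : ℝ) ≤ 1 / 2)
    (by norm_num)).mul_const (e n)
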